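/- Let $M$ be a compact Hausdorff smooth manifold without boundary, with a Poisson structure, i.e. a smooth bivector field $p$ such that the bracket $\{f,g\}=p(df,dg)$ on $C^\infty(M)$ satisfies the Jacobi identity. Give $C^\infty(M)$ the $C^\infty$ topology (uniform convergence of all derivatives on compact subsets of charts); a generalized function (distribution) on $M$ is a continuous linear functional on $C_0^\infty(M)$ (which equals $C^\infty(M)$, as $M$ is compact). For $f\in C^\infty(M)$ and a distribution $\Phi$ define $\{f,\Phi\}$ by $\langle\{f,\Phi\},\psi\rangle=\langle\Phi,\{\psi,f\}\rangle$ for $\psi\in C_0^\infty(M)$, and let $\mathcal D_0(M)$ be the space of generalized Casimirs, i.e. of distributions $\Phi$ with $\{f,\Phi\}=0$ for every $f\in C^\infty(M)$. Let $\delta=i_p\circ d-d\circ i_p:\Omega^{n+1}(M)\to\Omega^{n}(M)$ be the differential of Brylinski's canonical complex, and let $H_0^{\mathrm{can}}(M)=C^\infty(M)/\delta(\Omega^1(M))$ be its homology in degree $0$, with the quotient topology. Then $\delta(\Omega^1(M))=\{C^\infty(M),C^\infty(M)\}$ (the linear span of all brackets), so $H_0^{\mathrm{can}}(M)=C^\infty(M)/\{C^\infty(M),C^\infty(M)\}$,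 and the spaces $\mathcal D_0(M)$ and $H_0^{\mathrm{can}}(M)^*$ (the continuous linear functionals on $H_0^{\mathrm{can}}(M)$) are isomorphic: there is a linear isomorphism $e:\mathcal D_0(M)\to H_0^{\mathrm{can}}(M)^*$ with $e(\Phi)([\psi])=\langle\Phi,\psi\rangle$ for all $\Phi\in\mathcal D_0(M)$ and $\psi\in C^\infty(M)$. -/

import Mathlib

open scoped Manifold ContDiff Topology

noncomputable section

namespace PoissonCasimir

section Manifold

variable (E : Type*) [NormedAddCommGroup E] [NormedSpace ℝ E]
  (M : Type*) [TopologicalSpace M] [ChartedSpace E M]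

/-- The algebra `C^∞(M)` of smooth real functions on a (boundaryless) manifold `M` modelled
on `E`. -/
abbrev Smooth : Type _ := C^∞⟮𝓘(ℝ, E), M; 𝓘(ℝ, ℝ), ℝ⟯

/-- The `C^∞` topology on `C^∞(M)`: uniform convergence, on the compact subsets of the charts,
of the coordinate expression together with each of its derivatives. -/
instance smoothTopology : TopologicalSpace (Smooth E M) :=
  ⨅ (x₀ : M) (k : ℕ), TopologicalSpace.induced
    (fun f : Smooth E M =>
      UniformOnFun.ofFun {K : Set E | IsCompact K ∧ K ⊆ (extChartAt 𝓘(ℝ, E) x₀).target}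
        (iteratedFDeriv ℝ k (fun y : E => f ((extChartAt 𝓘(ℝ, E) x₀).symm y))))
    inferInstance

/-- The space `C_0^∞(M)` of smooth functions with compact support. -/
def testFunctions : Submodule ℝ (Smooth E M) where
  carrier := {f | HasCompactSupport f}
  add_mem' := fun hf hg => HasCompactSupport.add hf hg
  zero_mem' := HasCompactSupport.zero
  smul_mem' := fun c f hf =>
    HasCompactSupport.smul_left (f := fun _ => c) (f' := (f : M → ℝ)) hf

/-- The space of generalized functions (distributions) on `M`: linear functionals on `C_0^∞(M)`
that are continuous, i.e. whose restriction to the functions supported in `K` is continuous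
for the `C^∞` topology, for each compact `K`. -/
def distributions : Submodule ℝ (testFunctions E M →ₗ[ℝ] ℝ) where
  carrier := {Φ | ∀ K : Set M, IsCompact K →
    ContinuousOn Φ {ψ : testFunctions E M | tsupport (ψ : Smooth E M) ⊆ K}}
  add_mem' := fun hΦ hΨ K hK => (hΦ K hK).add (hΨ K hK)
  zero_mem' := fun _ _ => continuousOn_const
  smul_mem' := fun c _ hΦ K hK => (hΦ K hK).const_smul c

variable {E M}

/-- The differential of a smooth function at a point, as a covector. -/
def covector (f : Smooth E M) (x : M) : TangentSpace 𝓘(ℝ, E) x →L[ℝ] ℝ :=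
  mfderiv 𝓘(ℝ, E) 𝓘(ℝ, ℝ) f x

variable (E M)

/-- A (not necessarily smooth) field of exterior `n`-forms on the tangent spaces of `M`. -/
abbrev FormField (n : ℕ) : Type _ :=
  (x : M) → (TangentSpace 𝓘(ℝ, E) x) [⋀^Fin n]→L[ℝ] ℝ

variable {E M}

/-- The coordinate expression of `α` in the chart at `x₀`: the pullback of `α` by the inverse
of the chart. -/
def inChart {n : ℕ} (α : FormField E M n) (x₀ : M) (y : E) : E [⋀^Fin n]→L[ℝ] ℝ :=
  (α ((extChartAt 𝓘(ℝ, E) x₀).symm y)).compContinuousLinearMap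
    (mfderiv 𝓘(ℝ, E) 𝓘(ℝ, E) (extChartAt 𝓘(ℝ, E) x₀).symm y)

/-- The exterior derivative: at `x`, the exterior derivative of the coordinate expression in the
chart at `x`, pulled back by that chart. -/
def exteriorD {n : ℕ} (α : FormField E M n) : FormField E M (n + 1) := fun x =>
  (extDeriv (inChart α x) (extChartAt 𝓘(ℝ, E) x x)).compContinuousLinearMap
    (mfderiv 𝓘(ℝ, E) 𝓘(ℝ, E) (extChartAt 𝓘(ℝ, E) x) x)

variable (E M)

/-- The space `Ω^n(M)` of smooth differential `n`-forms. -/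
def smoothForms (n : ℕ) : Submodule ℝ (FormField E M n) where
  carrier := {α | ∀ x₀ : M, ContDiffOn ℝ ∞ (inChart α x₀) (extChartAt 𝓘(ℝ, E) x₀).target}
  add_mem' := fun {α η} hα hη x₀ => by
    have h : inChart (α + η) x₀ = inChart α x₀ + inChart η x₀ := by
      ext y v; rfl
    rw [h]; exact (hα x₀).add (hη x₀)
  zero_mem' := fun x₀ => by
    have h : inChart (0 : FormField E M n) x₀ = fun _ => 0 := by
      ext y v; rfl
    rw [h]; exact contDiffOn_const
  smul_mem' := fun c α hα x₀ => by
    have h : inChart (c • α) x₀ = c • inChart α x₀ := by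
      ext y v; rfl
    rw [h]; exact (hα x₀).const_smul c

variable {E M}

theorem d_add {n : ℕ} {α β : FormField E M n} (hα : α ∈ smoothForms E M n)
    (hβ : β ∈ smoothForms E M n) : exteriorD (α + β) = exteriorD α + exteriorD β := by
  funext x
  have hx := extChartAt_target_mem_nhds (I := 𝓘(ℝ, E)) x
  have h1 := ((hα x).contDiffAt hx).differentiableAt (by simp)
  have h2 := ((hβ x).contDiffAt hx).differentiableAt (by simp)
  have h : inChart (α + β) x = inChart α x + inChart β x := by
    ext y v; rfl
  simp only [exteriorD, Pi.add_apply]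
  rw [h, extDeriv_add h1 h2]
  rfl

theorem d_smul {n : ℕ} (c : ℝ) (α : FormField E M n) : exteriorD (c • α) = c • exteriorD α := by
  funext x
  have h : inChart (c • α) x = c • inChart α x := by
    ext y v; rfl
  simp only [exteriorD, Pi.smul_apply]
  rw [h, extDeriv_smul]
  rfl

variable (E M)

/-- A field of bivectors on `M`; an element of `⋀² T_x M` is given as an alternating bilinear
form on the cotangent space. -/
abbrev BivectorField : Type _ :=
  (x : M) → (TangentSpace 𝓘(ℝ, E) x →L[ℝ] ℝ) [⋀^Fin 2]→ₗ[ℝ] ℝ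

variable {E M}

/-- The function `{f, g} = p(df, dg)`. -/
def BivectorField.bracketFun (p : BivectorField E M) (f g : Smooth E M) (x : M) : ℝ :=
  p x ![covector f x, covector g x]

variable (E M)

/-- A Poisson structure on `M`: a smooth bivector field `p` such that the bracket
`{f, g} = p(df, dg)` on `C^∞(M)` satisfies the Jacobi identity. Smoothness of `p` means that
`p(df, dg)` is smooth for all smooth `f`, `g`. -/
structure PoissonStructure where
  bivector : BivectorField E M
  smooth : ∀ f g : Smooth E M, ContMDiff 𝓘(ℝ, E) 𝓘(ℝ, ℝ) ∞ (bivector.bracketFun f g)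
  jacobi : ∀ f g h : Smooth E M, ∀ x : M,
    bivector.bracketFun f ⟨bivector.bracketFun g h, smooth g h⟩ x +
    bivector.bracketFun g ⟨bivector.bracketFun h f, smooth h f⟩ x +
    bivector.bracketFun h ⟨bivector.bracketFun f g, smooth f g⟩ x = 0

end Manifold

section Poisson

/-- Contraction of an exterior form with a bivector: if `p = ½ ∑ p(eⁱ, eʲ) e_i ∧ e_j`, then
`i_p η = ½ ∑ p(eⁱ, eʲ) η(e_i, e_j, …)`. The result does not depend on the basis. In particular
`i_p (α ∧ β) = p(α, β)` for covectors `α`, `β`. -/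
def contract {E : Type*} [NormedAddCommGroup E] [NormedSpace ℝ E] [FiniteDimensional ℝ E]
    {n : ℕ} (p : (E →L[ℝ] ℝ) [⋀^Fin 2]→ₗ[ℝ] ℝ) (η : E [⋀^Fin (n + 2)]→L[ℝ] ℝ) :
    E [⋀^Fin n]→L[ℝ] ℝ :=
  (1 / 2 : ℝ) • ∑ i, ∑ j,
    p ![((Module.finBasis ℝ E).coord i).toContinuousLinearMap,
        ((Module.finBasis ℝ E).coord j).toContinuousLinearMap] •
      ((η.curryLeft (Module.finBasis ℝ E i)).curryLeft (Module.finBasis ℝ E j))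

variable {E : Type*} [NormedAddCommGroup E] [NormedSpace ℝ E]
  {M : Type*} [TopologicalSpace M] [ChartedSpace E M]

namespace PoissonStructure

/-- The Poisson bracket of two smooth functions. -/
def bracket (P : PoissonStructure E M) (f g : Smooth E M) : Smooth E M :=
  ⟨P.bivector.bracketFun f g, P.smooth f g⟩

theorem covector_add [IsManifold 𝓘(ℝ, E) ∞ M] (f g : Smooth E M) (x : M) :
    covector (f + g) x = covector f x + covector g x := by
  have hf : MDifferentiableAt 𝓘(ℝ, E) 𝓘(ℝ, ℝ) f x := f.contMDiff.mdifferentiable (by simp) x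
  have hg : MDifferentiableAt 𝓘(ℝ, E) 𝓘(ℝ, ℝ) g x := g.contMDiff.mdifferentiable (by simp) x
  exact mfderiv_add hf hg

theorem covector_smul [IsManifold 𝓘(ℝ, E) ∞ M] (c : ℝ) (f : Smooth E M) (x : M) :
    covector (c • f) x = c • covector f x := by
  have hf : MDifferentiableAt 𝓘(ℝ, E) 𝓘(ℝ, ℝ) f x := f.contMDiff.mdifferentiable (by simp) x
  exact const_smul_mfderiv hf c

theorem covector_eq_zero (f : Smooth E M) (x : M) (hx : x ∉ tsupport f) : covector f x = 0 := by
  have h : (f : M → ℝ) =ᶠ[𝓝 x] fun _ => (0 : ℝ) := notMem_tsupport_iff_eventuallyEq.mp hx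
  have h2 : mfderiv 𝓘(ℝ, E) 𝓘(ℝ, ℝ) f x
      = mfderiv 𝓘(ℝ, E) 𝓘(ℝ, ℝ) (fun _ : M => (0 : ℝ)) x := h.mfderiv_eq
  exact h2.trans mfderiv_const

theorem bracket_add_left [IsManifold 𝓘(ℝ, E) ∞ M] (P : PoissonStructure E M)
    (f g h : Smooth E M) : P.bracket (f + g) h = P.bracket f h + P.bracket g h := by
  ext x
  change P.bivector x ![covector (f + g) x, covector h x]
    = P.bivector x ![covector f x, covector h x] + P.bivector x ![covector g x, covector h x]
  rw [covector_add]
  exact (P.bivector x).toMultilinearMap.cons_add ![covector h x] _ _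

theorem bracket_smul_left [IsManifold 𝓘(ℝ, E) ∞ M] (P : PoissonStructure E M)
    (c : ℝ) (f h : Smooth E M) : P.bracket (c • f) h = c • P.bracket f h := by
  ext x
  change P.bivector x ![covector (c • f) x, covector h x]
    = c * P.bivector x ![covector f x, covector h x]
  rw [covector_smul]
  exact (P.bivector x).toMultilinearMap.cons_smul ![covector h x] c _

theorem bracket_hasCompactSupport (P : PoissonStructure E M) (ψ f : Smooth E M)
    (hψ : HasCompactSupport ψ) : HasCompactSupport (P.bracket ψ f) := by
  refine hψ.mono' ?_
  intro x hx
  by_contra h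
  apply hx
  change P.bivector x ![covector ψ x, covector f x] = 0
  rw [covector_eq_zero ψ x h]
  exact (P.bivector x).toMultilinearMap.map_coord_zero 0 rfl

variable [IsManifold 𝓘(ℝ, E) ∞ M]

/-- The operator `ψ ↦ {ψ, f}` on compactly supported functions. -/
def bracketRight (P : PoissonStructure E M) (f : Smooth E M) :
    testFunctions E M →ₗ[ℝ] testFunctions E M where
  toFun ψ := ⟨P.bracket ψ f, P.bracket_hasCompactSupport ψ f ψ.2⟩
  map_add' ψ φ := Subtype.ext (P.bracket_add_left ψ φ f)
  map_smul' c ψ := Subtype.ext (P.bracket_smul_left c ψ f)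

/-- The Poisson bracket `{f, Φ} = X_f(Φ)` of a smooth function and a functional on `C_0^∞(M)`:
`⟨{f, Φ}, ψ⟩ = -⟨Φ, X_f(ψ)⟩ = ⟨Φ, {ψ, f}⟩`. -/
def bracketDistribution (P : PoissonStructure E M) (f : Smooth E M)
    (Φ : testFunctions E M →ₗ[ℝ] ℝ) : testFunctions E M →ₗ[ℝ] ℝ :=
  Φ ∘ₗ P.bracketRight f

/-- The space of generalized Casimir functions: the distributions `Φ` with `{f, Φ} = 0` for every
smooth function `f`. -/
def generalizedCasimirs (P : PoissonStructure E M) : Submodule ℝ (distributions E M) where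
  carrier := {Φ | ∀ f : Smooth E M, P.bracketDistribution f Φ = 0}
  add_mem' := fun {Φ Ψ} hΦ hΨ f => by
    have h : P.bracketDistribution f ((Φ + Ψ : distributions E M) : testFunctions E M →ₗ[ℝ] ℝ)
      = P.bracketDistribution f Φ + P.bracketDistribution f Ψ := rfl
    rw [h, hΦ f, hΨ f, add_zero]
  zero_mem' := fun _ => rfl
  smul_mem' := fun c Φ hΦ f => by
    have h : P.bracketDistribution f ((c • Φ : distributions E M) : testFunctions E M →ₗ[ℝ] ℝ)
      = c • P.bracketDistribution f Φ := rfl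
    rw [h, hΦ f, smul_zero]

variable [FiniteDimensional ℝ E]

/-- Contraction `i_p : Ω^{n+2} → Ω^n` with the Poisson bivector. -/
def interior (P : PoissonStructure E M) {n : ℕ} (α : FormField E M (n + 2)) : FormField E M n :=
  fun x => contract (E := E) (P.bivector x) (α x)

/-- The differential `δ = i_p ∘ d - d ∘ i_p : Ω^{n+1} → Ω^n` of the canonical complex; on `1`-forms
`i_p` vanishes for degree reasons. -/
def canonicalDifferential (P : PoissonStructure E M) :
    (n : ℕ) → FormField E M (n + 1) → FormField E M n
  | 0, α => P.interior (exteriorD α)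
  | _ + 1, α => P.interior (exteriorD α) - exteriorD (P.interior α)

theorem contract_add {n : ℕ} (p : (E →L[ℝ] ℝ) [⋀^Fin 2]→ₗ[ℝ] ℝ)
    (η θ : E [⋀^Fin (n + 2)]→L[ℝ] ℝ) : contract p (η + θ) = contract p η + contract p θ := by
  simp only [contract, ContinuousAlternatingMap.curryLeft_add, add_apply,
    smul_add, Finset.sum_add_distrib]

theorem contract_smul {n : ℕ} (p : (E →L[ℝ] ℝ) [⋀^Fin 2]→ₗ[ℝ] ℝ) (c : ℝ)
    (η : E [⋀^Fin (n + 2)]→L[ℝ] ℝ) : contract p (c • η) = c • contract p η := by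
  simp only [contract, ContinuousAlternatingMap.curryLeft_smul, smul_apply,
    Finset.smul_sum]
  simp only [smul_comm c]

theorem canonicalDifferential_zero_add (P : PoissonStructure E M) {α β : FormField E M 1}
    (hα : α ∈ smoothForms E M 1) (hβ : β ∈ smoothForms E M 1) :
    P.canonicalDifferential 0 (α + β)
      = P.canonicalDifferential 0 α + P.canonicalDifferential 0 β := by
  funext x
  change contract (E := E) (P.bivector x) (exteriorD (α + β) x) = _
  rw [d_add hα hβ]
  exact contract_add _ _ _

theorem canonicalDifferential_zero_smul (P : PoissonStructure E M) (c : ℝ) (α : FormField E M 1) :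
    P.canonicalDifferential 0 (c • α) = c • P.canonicalDifferential 0 α := by
  funext x
  change contract (E := E) (P.bivector x) (exteriorD (c • α) x) = _
  rw [d_smul c α]
  exact contract_smul _ _ _

/-- The space `δ(Ω¹(M))` of boundaries in degree `0`, where `Ω⁰(M)` is identified with `C^∞(M)`
(a `0`-form is a function with values in the forms of no arguments). -/
def boundaries (P : PoissonStructure E M) : Submodule ℝ (Smooth E M) where
  carrier := {f | ∃ α ∈ smoothForms E M 1, ∀ x, f x = P.canonicalDifferential 0 α x ![]}
  add_mem' := by
    rintro f g ⟨α, hα, hf⟩ ⟨β, hβ, hg⟩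
    refine ⟨α + β, (smoothForms E M 1).add_mem hα hβ, fun x => ?_⟩
    change f x + g x = _
    rw [hf x, hg x, canonicalDifferential_zero_add P hα hβ]
    rfl
  zero_mem' := by
    refine ⟨(0 : ℝ) • 0, by simp, fun x => ?_⟩
    rw [canonicalDifferential_zero_smul]
    simp
  smul_mem' := by
    rintro c f ⟨α, hα, hf⟩
    refine ⟨c • α, (smoothForms E M 1).smul_mem c hα, fun x => ?_⟩
    change c * f x = _
    rw [hf x, canonicalDifferential_zero_smul]
    rfl

/-- The homology `H_0^can(M) = C^∞(M) / δ(Ω¹(M))` of the canonical complex in degree `0` (every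
`0`-form is a cycle), with the quotient topology. -/
abbrev H0 (P : PoissonStructure E M) : Type _ := Smooth E M ⧸ P.boundaries

end PoissonStructure

end Poisson

end PoissonCasimir

end

/-!
A partition of unity subordinate to coordinate charts writes every `1`-form on the compact manifold
`M` as a finite sum of forms `f dg`, and `δ(f dg) = i_p(df ∧ dg) = {f, g}`. Hence `δ(Ω¹(M))` is the
span of the brackets. Since `M` is compact, the distributions on `M` are the continuous linear
functionals on `C^∞(M)`; such a functional is a generalized Casimir iff it vanishes on every
bracket, that is, iff it descends to a continuous functional on `H_0^can(M)`.
-/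

noncomputable section

namespace PoissonCasimir

section Wedge

variable {𝕜 E F : Type*} [NontriviallyNormedField 𝕜] [NormedAddCommGroup E] [NormedSpace 𝕜 E]
  [NormedAddCommGroup F] [NormedSpace 𝕜 F]

/-- The wedge product `a ∧ b` of two covectors. It is normalized by
`(a ∧ b)(u, v) = a(u) b(v) - a(v) b(u)`, which is the convention of `extDeriv`. -/
def wedge (a b : E →L[𝕜] 𝕜) : E [⋀^Fin 2]→L[𝕜] 𝕜 :=
  .alternatizeUncurryFin (a.smulRight (.ofSubsingleton 𝕜 E 𝕜 (0 : Fin 1) b))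

theorem wedge_apply (a b : E →L[𝕜] 𝕜) (v : Fin 2 → E) :
    wedge a b v = a (v 0) * b (v 1) - a (v 1) * b (v 0) := by
  simp [wedge, ContinuousAlternatingMap.alternatizeUncurryFin_apply, Fin.sum_univ_two,
    Fin.removeNth, sub_eq_add_neg]

theorem wedge_compContinuousLinearMap (a b : F →L[𝕜] 𝕜) (L : E →L[𝕜] F) :
    (wedge a b).compContinuousLinearMap L = wedge (a ∘L L) (b ∘L L) := by
  ext v
  simp [wedge_apply]

theorem extDeriv_smul_form {n : ℕ} {f : E → 𝕜} {η : E → E [⋀^Fin n]→L[𝕜] F} {x : E}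
    (hf : DifferentiableAt 𝕜 f x) (hη : DifferentiableAt 𝕜 η x) :
    extDeriv (fun y => f y • η y) x =
      f x • extDeriv η x + .alternatizeUncurryFin ((fderiv 𝕜 f x).smulRight (η x)) := by
  rw [extDeriv, fderiv_fun_smul hf hη, ContinuousAlternatingMap.alternatizeUncurryFin_add,
    ContinuousAlternatingMap.alternatizeUncurryFin_smul, extDeriv]

theorem extDeriv_smul_fderiv {f g : E → 𝕜} {x : E} {r : WithTop ℕ∞}
    (hf : DifferentiableAt 𝕜 f x) (hg : ContDiffAt 𝕜 r g x) (hr : minSmoothness 𝕜 2 ≤ r) :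
    extDeriv (fun y => f y • ContinuousAlternatingMap.ofSubsingleton 𝕜 E 𝕜 (0 : Fin 1)
      (fderiv 𝕜 g y)) x = wedge (fderiv 𝕜 f x) (fderiv 𝕜 g x) := by
  let G : E → E [⋀^Fin 0]→L[𝕜] 𝕜 := fun y => .constOfIsEmpty 𝕜 E (Fin 0) (g y)
  have hG : ContDiffAt 𝕜 r G x :=
    (ContinuousAlternatingMap.constOfIsEmptyLIE 𝕜 E 𝕜 (Fin 0)).contDiff.contDiffAt.comp x hg
  have hdG : extDeriv G = fun y => .ofSubsingleton 𝕜 E 𝕜 (0 : Fin 1) (fderiv 𝕜 g y) :=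
    funext (extDeriv_constOfIsEmpty g)
  have hddG : extDeriv (extDeriv G) x = 0 := extDeriv_extDeriv_apply hG hr
  have hdG_diff : DifferentiableAt 𝕜 (extDeriv G) x := by
    rw [hdG]
    have hg' : DifferentiableAt 𝕜 (fderiv 𝕜 g) x :=
      (hg.fderiv_right (m := 1) ((le_minSmoothness (𝕜 := 𝕜) (n := 2)).trans hr)).differentiableAt
        one_ne_zero
    exact (ContinuousAlternatingMap.ofSubsingletonLIE (𝕜 := 𝕜) (E := E) (F := 𝕜)
      (0 : Fin 1)).differentiableAt.comp x hg'
  rw [hdG] at hddG hdG_diff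
  rw [extDeriv_smul_form hf hdG_diff, hddG, smul_zero, zero_add, wedge]

end Wedge

section Basis

variable {𝕜 E ι : Type*} [NontriviallyNormedField 𝕜] [CompleteSpace 𝕜]
  [NormedAddCommGroup E] [NormedSpace 𝕜 E] [FiniteDimensional 𝕜 E] [Fintype ι]
  (b : Module.Basis ι 𝕜 E)

theorem sum_apply_smul_coord (a : E →L[𝕜] 𝕜) :
    ∑ i, a (b i) • (b.coord i).toContinuousLinearMap = a := by
  refine ContinuousLinearMap.coe_injective ?_
  simpa using b.sum_dual_apply_smul_coord a

theorem compContinuousLinearMap_eq_sum_coord {F : Type*} [NormedAddCommGroup F] [NormedSpace 𝕜 F]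
    (η : E [⋀^Fin 1]→L[𝕜] 𝕜) (L : F →L[𝕜] E) :
    η.compContinuousLinearMap L = ∑ i, η (fun _ => b i) •
      ContinuousAlternatingMap.ofSubsingleton 𝕜 F 𝕜 (0 : Fin 1)
        ((b.coord i).toContinuousLinearMap ∘L L) := by
  obtain ⟨a, rfl⟩ := (ContinuousAlternatingMap.ofSubsingletonLIE (0 : Fin 1)).surjective η
  ext v
  rw [ContinuousAlternatingMap.sum_apply]
  have h := DFunLike.congr_fun (sum_apply_smul_coord b a) (L (v 0))
  rw [sum_apply] at h
  exact h.symm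

theorem bivector_apply_eq_sum (p : (E →L[𝕜] 𝕜) [⋀^Fin 2]→ₗ[𝕜] 𝕜) (a c : E →L[𝕜] 𝕜) :
    p ![a, c] = ∑ i, ∑ j, a (b i) * c (b j) *
      p ![(b.coord i).toContinuousLinearMap, (b.coord j).toContinuousLinearMap] := by
  classical
  have hsum : ![a, c] =
      fun k => ∑ i, ![a, c] k (b i) • (b.coord i).toContinuousLinearMap :=
    funext fun k => (sum_apply_smul_coord b _).symm
  rw [hsum]
  change p.toMultilinearMap _ = _
  rw [MultilinearMap.map_sum, ← Fintype.sum_prod_type']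
  refine Fintype.sum_equiv (finTwoArrowEquiv ι) _ _ fun r => ?_
  have hr : (fun k => (b.coord (r k)).toContinuousLinearMap) =
      ![(b.coord (r 0)).toContinuousLinearMap, (b.coord (r 1)).toContinuousLinearMap] := by
    ext k
    fin_cases k <;> rfl
  rw [MultilinearMap.map_smul_univ, Fin.prod_univ_two, hr]
  rfl

end Basis

theorem contract_wedge {E : Type*} [NormedAddCommGroup E] [NormedSpace ℝ E]
    [FiniteDimensional ℝ E] (p : (E →L[ℝ] ℝ) [⋀^Fin 2]→ₗ[ℝ] ℝ) (a c : E →L[ℝ] ℝ) :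
    contract (n := 0) p (wedge a c) ![] = p ![a, c] := by
  have hswap : p ![c, a] = -p ![a, c] := by
    rw [← p.map_swap ![a, c] (i := 0) (j := 1) (by simp)]
    congr 1
    ext k
    fin_cases k <;> rfl
  have hcontract : contract (n := 0) p (wedge a c) ![] = 1 / 2 * (p ![a, c] - p ![c, a]) := by
    rw [bivector_apply_eq_sum (Module.finBasis ℝ E) p a c,
      bivector_apply_eq_sum (Module.finBasis ℝ E) p c a]
    simp only [← Finset.sum_sub_distrib]
    simp only [contract, ContinuousAlternatingMap.smul_apply,
      ContinuousAlternatingMap.sum_apply, smul_eq_mul]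
    congr! 3 with i _ j _
    change _ * wedge a c ![Module.finBasis ℝ E i, Module.finBasis ℝ E j] = _
    simp only [wedge_apply, Matrix.cons_val_zero, Matrix.cons_val_one, Matrix.cons_val_fin_one]
    ring
  rw [hcontract, hswap]
  ring

section Forms

variable {E : Type*} [NormedAddCommGroup E] [NormedSpace ℝ E]
  {M : Type*} [TopologicalSpace M] [ChartedSpace E M]

/-- The differential `dg` as a `1`-form. The product `f dg` is then `⇑f • differential g`. -/
def differential (g : Smooth E M) : FormField E M 1 := fun x =>
  .ofSubsingleton ℝ (TangentSpace 𝓘(ℝ, E) x) ℝ (0 : Fin 1) (covector g x)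

theorem inChart_smul {n : ℕ} (f : M → ℝ) (α : FormField E M n) (c : M) :
    inChart (f • α) c = (f ∘ (extChartAt 𝓘(ℝ, E) c).symm) • inChart α c :=
  rfl

section C1

variable [IsManifold 𝓘(ℝ, E) 1 M]

theorem mfderiv_extChartAt_symm_comp_mfderiv_extChartAt {c x : M}
    (hx : x ∈ (extChartAt 𝓘(ℝ, E) c).source) :
    (mfderiv 𝓘(ℝ, E) 𝓘(ℝ, E) (extChartAt 𝓘(ℝ, E) c).symm (extChartAt 𝓘(ℝ, E) c x)) ∘L
      (mfderiv 𝓘(ℝ, E) 𝓘(ℝ, E) (extChartAt 𝓘(ℝ, E) c) x) = ContinuousLinearMap.id _ _ := by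
  have h := mfderivWithin_extChartAt_symm_comp_mfderiv_extChartAt' hx
  rwa [modelWithCornersSelf_coe, Set.range_id, mfderivWithin_univ] at h

theorem mdifferentiableAt_extChartAt_symm {c : M} {y : E}
    (hy : y ∈ (extChartAt 𝓘(ℝ, E) c).target) :
    MDifferentiableAt 𝓘(ℝ, E) 𝓘(ℝ, E) (extChartAt 𝓘(ℝ, E) c).symm y := by
  have h := mdifferentiableWithinAt_extChartAt_symm hy
  rwa [modelWithCornersSelf_coe, Set.range_id, mdifferentiableWithinAt_univ] at h

theorem fderiv_comp_extChartAt_symm (f : Smooth E M) {c : M} {y : E}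
    (hy : y ∈ (extChartAt 𝓘(ℝ, E) c).target) :
    fderiv ℝ (f ∘ (extChartAt 𝓘(ℝ, E) c).symm) y =
      covector f ((extChartAt 𝓘(ℝ, E) c).symm y) ∘L
        mfderiv 𝓘(ℝ, E) 𝓘(ℝ, E) (extChartAt 𝓘(ℝ, E) c).symm y := by
  rw [← mfderiv_eq_fderiv]
  exact mfderiv_comp y (f.contMDiff.mdifferentiable (by simp) _)
    (mdifferentiableAt_extChartAt_symm hy)

theorem inChart_differential (g : Smooth E M) {c : M} {y : E}
    (hy : y ∈ (extChartAt 𝓘(ℝ, E) c).target) :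
    inChart (differential g) c y = .ofSubsingleton ℝ E ℝ (0 : Fin 1)
      (fderiv ℝ (g ∘ (extChartAt 𝓘(ℝ, E) c).symm) y) := by
  rw [fderiv_comp_extChartAt_symm g hy]
  rfl

theorem inChart_compContinuousLinearMap_mfderiv {n : ℕ} (α : FormField E M n) {c x : M}
    (hx : x ∈ (extChartAt 𝓘(ℝ, E) c).source) :
    (inChart α c (extChartAt 𝓘(ℝ, E) c x)).compContinuousLinearMap
      (mfderiv 𝓘(ℝ, E) 𝓘(ℝ, E) (extChartAt 𝓘(ℝ, E) c) x) = α x := by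
  have h := mfderiv_extChartAt_symm_comp_mfderiv_extChartAt hx
  have key : ∀ z, z = x → ∀ L : E →L[ℝ] E, L = ContinuousLinearMap.id ℝ E →
      (show E [⋀^Fin n]→L[ℝ] ℝ from α z).compContinuousLinearMap L = α x := by
    rintro z rfl L rfl
    rfl
  exact key _ ((extChartAt 𝓘(ℝ, E) c).left_inv hx) _ h

theorem covector_eq_comp_mfderiv_extChartAt {g : Smooth E M} {u : E → ℝ} {c x : M}
    (hx : x ∈ (extChartAt 𝓘(ℝ, E) c).source)
    (hu : DifferentiableAt ℝ u (extChartAt 𝓘(ℝ, E) c x))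
    (hg : g =ᶠ[𝓝 x] u ∘ extChartAt 𝓘(ℝ, E) c) :
    covector g x = fderiv ℝ u (extChartAt 𝓘(ℝ, E) c x) ∘L
      mfderiv 𝓘(ℝ, E) 𝓘(ℝ, E) (extChartAt 𝓘(ℝ, E) c) x := by
  have h : covector g x = mfderiv 𝓘(ℝ, E) 𝓘(ℝ, ℝ) (u ∘ extChartAt 𝓘(ℝ, E) c) x := hg.mfderiv_eq
  rw [h, ← mfderiv_eq_fderiv]
  exact mfderiv_comp x hu.mdifferentiableAt (mdifferentiableAt_extChartAt (by simpa using hx))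

end C1

variable [IsManifold 𝓘(ℝ, E) ∞ M]

theorem contDiffOn_comp_extChartAt_symm (f : Smooth E M) (c : M) :
    ContDiffOn ℝ ∞ (f ∘ (extChartAt 𝓘(ℝ, E) c).symm) (extChartAt 𝓘(ℝ, E) c).target :=
  contMDiffOn_iff_contDiffOn.1 (f.contMDiff.comp_contMDiffOn (contMDiffOn_extChartAt_symm c))

theorem smul_mem_smoothForms {n : ℕ} (f : Smooth E M) {α : FormField E M n}
    (hα : α ∈ smoothForms E M n) : ⇑f • α ∈ smoothForms E M n := fun c =>
  (contDiffOn_comp_extChartAt_symm f c).smul (hα c)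

theorem differential_mem_smoothForms (g : Smooth E M) : differential g ∈ smoothForms E M 1 :=
  fun c => by
    have hdg : ContDiffOn ℝ ∞ (fderiv ℝ (g ∘ (extChartAt 𝓘(ℝ, E) c).symm))
        (extChartAt 𝓘(ℝ, E) c).target :=
      (contDiffOn_comp_extChartAt_symm g c).fderiv_of_isOpen (isOpen_extChartAt_target c)
        (by simp)
    exact ((ContinuousAlternatingMap.ofSubsingletonLIE (𝕜 := ℝ) (E := E) (F := ℝ)
      (0 : Fin 1)).contDiff.comp_contDiffOn hdg).congr fun y hy => inChart_differential g hy

theorem exteriorD_smul_differential (f g : Smooth E M) (x : M) :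
    exteriorD (⇑f • differential g) x = wedge (E := E) (covector f x) (covector g x) := by
  have htarget := extChartAt_target_mem_nhds (I := 𝓘(ℝ, E)) x
  have hsmooth (h : Smooth E M) : ContDiffAt ℝ ∞ (h ∘ (extChartAt 𝓘(ℝ, E) x).symm)
      (extChartAt 𝓘(ℝ, E) x x) :=
    (contDiffOn_comp_extChartAt_symm h x).contDiffAt htarget
  have hcovector (h : Smooth E M) : fderiv ℝ (h ∘ (extChartAt 𝓘(ℝ, E) x).symm)
      (extChartAt 𝓘(ℝ, E) x x) ∘L mfderiv 𝓘(ℝ, E) 𝓘(ℝ, E) (extChartAt 𝓘(ℝ, E) x) x =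
        covector h x := by
    refine (covector_eq_comp_mfderiv_extChartAt (mem_extChartAt_source x)
      ((hsmooth h).differentiableAt (by simp)) ?_).symm
    filter_upwards [extChartAt_source_mem_nhds (I := 𝓘(ℝ, E)) x] with z hz
    exact congrArg h ((extChartAt 𝓘(ℝ, E) x).left_inv hz).symm
  have hchart : inChart (⇑f • differential g) x =ᶠ[𝓝 (extChartAt 𝓘(ℝ, E) x x)] fun y =>
      (f ∘ (extChartAt 𝓘(ℝ, E) x).symm) y • .ofSubsingleton ℝ E ℝ (0 : Fin 1)
        (fderiv ℝ (g ∘ (extChartAt 𝓘(ℝ, E) x).symm) y) := by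
    filter_upwards [htarget] with y hy
    rw [inChart_smul, Pi.smul_apply', inChart_differential g hy]
  have htwo : minSmoothness ℝ 2 ≤ (∞ : WithTop ℕ∞) := by
    rw [minSmoothness_of_isRCLikeNormedField]
    exact WithTop.coe_le_coe.2 (le_top : (2 : ℕ∞) ≤ ⊤)
  rw [exteriorD, hchart.extDeriv_eq,
    extDeriv_smul_fderiv ((hsmooth f).differentiableAt (by simp)) (hsmooth g) htwo]
  exact (wedge_compContinuousLinearMap (E := E) (F := E) _ _ _).trans
    (congrArg₂ wedge (hcovector f) (hcovector g))

end Forms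

section Decomposition

theorem exists_contMDiffMap_eventuallyEq_comp_extChartAt {E H F M : Type*}
    [NormedAddCommGroup E] [NormedSpace ℝ E] [FiniteDimensional ℝ E] [TopologicalSpace H]
    {I : ModelWithCorners ℝ E H} [NormedAddCommGroup F] [NormedSpace ℝ F] [TopologicalSpace M]
    [ChartedSpace H M] [IsManifold I ∞ M] [T2Space M] {c : M} {u : E → F}
    (hu : ContDiffOn ℝ ∞ u (extChartAt I c).target) :
    ∃ g : C^∞⟮I, M; 𝓘(ℝ, F), F⟯, g =ᶠ[𝓝 c] u ∘ extChartAt I c := by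
  let χ : SmoothBumpFunction I c := Classical.arbitrary _
  have hsource : Set.MapsTo (extChartAt I c) (chartAt H c).source (extChartAt I c).target :=
    fun x hx => (extChartAt I c).map_source (by rwa [extChartAt_source])
  refine ⟨⟨_, χ.contMDiff_smul (hu.contMDiffOn.comp contMDiffOn_extChartAt hsource)⟩, ?_⟩
  filter_upwards [χ.eventuallyEq_one] with x hx
  exact (congrArg (· • u (extChartAt I c x)) hx).trans (one_smul ℝ _)

variable {E : Type*} [NormedAddCommGroup E] [NormedSpace ℝ E] [FiniteDimensional ℝ E]
  {M : Type*} [TopologicalSpace M] [ChartedSpace E M] [IsManifold 𝓘(ℝ, E) ∞ M] [T2Space M]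

theorem exists_eventually_eq_sum_smul_differential {ι : Type*} [Fintype ι]
    (b : Module.Basis ι ℝ E) {α : FormField E M 1} (hα : α ∈ smoothForms E M 1) (c : M) :
    ∃ a g : ι → Smooth E M, ∀ᶠ x in 𝓝 c, α x = ∑ j, a j x • differential (g j) x := by
  have hcoeff (j : ι) : ∃ a : Smooth E M,
      a =ᶠ[𝓝 c] (fun y => inChart α c y fun _ => b j) ∘ extChartAt 𝓘(ℝ, E) c :=
    exists_contMDiffMap_eventuallyEq_comp_extChartAt
      ((ContinuousAlternatingMap.apply ℝ E ℝ fun _ : Fin 1 => b j).contDiff.comp_contDiffOn (hα c))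
  have hcoord (j : ι) : ∃ g : Smooth E M,
      g =ᶠ[𝓝 c] (b.coord j).toContinuousLinearMap ∘ extChartAt 𝓘(ℝ, E) c :=
    exists_contMDiffMap_eventuallyEq_comp_extChartAt
      (b.coord j).toContinuousLinearMap.contDiff.contDiffOn
  choose a ha using hcoeff
  choose g hg using hcoord
  refine ⟨a, g, ?_⟩
  filter_upwards [extChartAt_source_mem_nhds (I := 𝓘(ℝ, E)) c, Filter.eventually_all.2 ha,
    Filter.eventually_all.2 fun j => (hg j).eventually_nhds] with x hx hax hgx
  have hdg (j : ι) : covector (g j) x = (b.coord j).toContinuousLinearMap ∘L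
      mfderiv 𝓘(ℝ, E) 𝓘(ℝ, E) (extChartAt 𝓘(ℝ, E) c) x := by
    rw [covector_eq_comp_mfderiv_extChartAt hx
      (b.coord j).toContinuousLinearMap.differentiableAt (hgx j), ContinuousLinearMap.fderiv]
  refine (inChart_compContinuousLinearMap_mfderiv α hx).symm.trans
    ((compContinuousLinearMap_eq_sum_coord (F := E) b _ _).trans ?_)
  refine Finset.sum_congr rfl fun j _ => ?_
  rw [hax, differential, hdg]
  rfl

theorem smoothForms_one_eq_span [CompactSpace M] :
    smoothForms E M 1 =
      Submodule.span ℝ {α | ∃ f g : Smooth E M, α = ⇑f • differential g} := by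
  refine le_antisymm (fun α hα => ?_) (Submodule.span_le.2 ?_)
  · choose a g hag using
      exists_eventually_eq_sum_smul_differential (Module.finBasis ℝ E) hα
    let U (c : M) : Set M := {x | α x = ∑ j, a c j x • differential (g c j) x}
    obtain ⟨ρ, hρ⟩ := SmoothPartitionOfUnity.exists_isSubordinate 𝓘(ℝ, E)
      (isClosed_univ (X := M)) (fun c => interior (U c)) (fun _ => isOpen_interior) fun c _ =>
        Set.mem_iUnion.2 ⟨c, mem_interior_iff_mem_nhds.2 (hag c)⟩
    have hfin := ρ.locallyFinite.finite_nonempty_of_compact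
    have hlocal (c x : M) (hx : x ∈ tsupport (ρ c)) :
        α x = ∑ j, a c j x • differential (g c j) x := interior_subset (s := U c) (hρ c hx)
    have hterm (c x : M) : ρ c x • α x = ∑ j, (ρ c x * a c j x) • differential (g c j) x := by
      by_cases hx : x ∈ tsupport (ρ c)
      · simp only [hlocal c x hx, Finset.smul_sum, mul_smul]
      · simp [image_eq_zero_of_notMem_tsupport hx]
    have hsum : α = ∑ c ∈ hfin.toFinset, ∑ j, ⇑(ρ c * a c j) • differential (g c j) := by
      funext x
      have hρx : ∑ c ∈ hfin.toFinset, ρ c x = 1 := by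
        refine ρ.sum_finsupport' x (Set.mem_univ x) fun c hc => ?_
        rw [Set.Finite.mem_toFinset]
        exact ⟨x, (ρ.mem_finsupport x).1 hc⟩
      calc α x = ∑ c ∈ hfin.toFinset, ρ c x • α x := by rw [← Finset.sum_smul, hρx, one_smul]
        _ = ∑ c ∈ hfin.toFinset, ∑ j, (ρ c x * a c j x) • differential (g c j) x :=
          Finset.sum_congr rfl fun c _ => hterm c x
        _ = _ := by simp only [Finset.sum_apply]; rfl
    rw [hsum]
    exact Submodule.sum_mem _ fun c _ => Submodule.sum_mem _ fun j _ =>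
      Submodule.subset_span ⟨_, _, rfl⟩
  · rintro _ ⟨f, g, rfl⟩
    exact smul_mem_smoothForms f (differential_mem_smoothForms g)

end Decomposition

section Distributions

variable (E M : Type*) [NormedAddCommGroup E] [NormedSpace ℝ E] [TopologicalSpace M]
  [ChartedSpace E M] [CompactSpace M]

/-- On a compact manifold every smooth function is a test function. -/
def toTestFunctions : Smooth E M →L[ℝ] testFunctions E M :=
  (ContinuousLinearMap.id ℝ (Smooth E M)).codRestrict _ fun f => .of_compactSpace f

/-- On a compact manifold the distributions are the continuous dual of `C^∞(M)`. -/
def distributionsEquivDual : distributions E M ≃ₗ[ℝ] (Smooth E M →L[ℝ] ℝ) where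
  toFun Φ :=
    ⟨(Φ : testFunctions E M →ₗ[ℝ] ℝ) ∘ₗ (toTestFunctions E M).toLinearMap,
      (continuousOn_univ.1 ((Φ.2 Set.univ isCompact_univ).mono fun _ _ =>
        Set.subset_univ _)).comp (toTestFunctions E M).continuous⟩
  invFun L := ⟨L.toLinearMap ∘ₗ (testFunctions E M).subtype, fun _ _ =>
    (L.continuous.comp continuous_subtype_val).continuousOn⟩
  map_add' _ _ := rfl
  map_smul' _ _ := rfl
  left_inv _ := rfl
  right_inv _ := rfl

end Distributions

namespace PoissonStructure

variable {E : Type*} [NormedAddCommGroup E] [NormedSpace ℝ E]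
  {M : Type*} [TopologicalSpace M] [ChartedSpace E M] [IsManifold 𝓘(ℝ, E) ∞ M]
  (P : PoissonStructure E M)

theorem mem_generalizedCasimirs_iff [CompactSpace M] {Φ : distributions E M} :
    Φ ∈ P.generalizedCasimirs ↔
      Submodule.span ℝ {h | ∃ f g, h = P.bracket f g} ≤
        LinearMap.ker (distributionsEquivDual E M Φ).toLinearMap := by
  rw [Submodule.span_le]
  constructor
  · rintro hΦ _ ⟨f, g, rfl⟩
    exact LinearMap.congr_fun (hΦ g) (toTestFunctions E M f)
  · intro hΦ g
    ext ψ
    exact hΦ ⟨ψ, g, rfl⟩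

variable [FiniteDimensional ℝ E]

theorem canonicalDifferential_smul_differential (f g : Smooth E M) (x : M) :
    P.canonicalDifferential 0 (⇑f • differential g) x ![] = P.bracket f g x := by
  change contract (E := E) (P.bivector x) (exteriorD (⇑f • differential g) x) ![] = _
  rw [exteriorD_smul_differential]
  exact contract_wedge (E := E) _ _ _

/-- The boundary operator `δ : Ω¹(M) → Ω⁰(M)`, with `0`-forms regarded as functions on `M`. -/
def boundaryMap : smoothForms E M 1 →ₗ[ℝ] (M → ℝ) where
  toFun α x := P.canonicalDifferential 0 α x ![]
  map_add' α β := by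
    funext x
    change P.canonicalDifferential 0 (α + β : FormField E M 1) x ![] = _
    rw [P.canonicalDifferential_zero_add α.2 β.2]
    rfl
  map_smul' r α := by
    funext x
    change P.canonicalDifferential 0 (r • α : FormField E M 1) x ![] = _
    rw [P.canonicalDifferential_zero_smul]
    rfl

variable [T2Space M] [CompactSpace M]

theorem boundaries_eq_span_bracket :
    P.boundaries = Submodule.span ℝ {h | ∃ f g, h = P.bracket f g} := by
  have hle : smoothForms E M 1 ≤
      (((Submodule.span ℝ {h | ∃ f g, h = P.bracket f g}).map
        ContMDiffMap.coeFnLinearMap).comap P.boundaryMap).map (smoothForms E M 1).subtype := by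
    refine smoothForms_one_eq_span.le.trans (Submodule.span_le.2 ?_)
    rintro _ ⟨f, g, rfl⟩
    exact ⟨⟨_, smul_mem_smoothForms f (differential_mem_smoothForms g)⟩,
      ⟨P.bracket f g, Submodule.subset_span ⟨f, g, rfl⟩,
        funext fun x => (P.canonicalDifferential_smul_differential f g x).symm⟩, rfl⟩
  refine le_antisymm ?_ (Submodule.span_le.2 ?_)
  · rintro f ⟨α, hα, hf⟩
    obtain ⟨_, ⟨h, hh, hδ⟩, rfl⟩ := hle hα
    rwa [show f = h from ContMDiffMap.ext fun x => (hf x).trans (congrFun hδ x).symm]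
  · rintro _ ⟨f, g, rfl⟩
    exact ⟨_, smul_mem_smoothForms f (differential_mem_smoothForms g), fun x =>
      (P.canonicalDifferential_smul_differential f g x).symm⟩

/-- The identification of the generalized Casimirs with the continuous dual of `H_0^can(M)`:
a distribution on `M` is a generalized Casimir iff it descends to the quotient `H_0^can(M)`. -/
def casimirEquivDual : P.generalizedCasimirs ≃ₗ[ℝ] (P.H0 →L[ℝ] ℝ) where
  toFun Φ := P.boundaries.liftQL (distributionsEquivDual E M Φ)
    (P.boundaries_eq_span_bracket.le.trans (P.mem_generalizedCasimirs_iff.1 Φ.2))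
  invFun L := ⟨(distributionsEquivDual E M).symm (L ∘L P.boundaries.mkQL), by
    rw [mem_generalizedCasimirs_iff, LinearEquiv.apply_symm_apply, ← boundaries_eq_span_bracket]
    exact P.boundaries.ker_mkQ.ge.trans (LinearMap.ker_le_ker_comp _ L.toLinearMap)⟩
  map_add' _ _ := ContinuousLinearMap.coe_injective (Submodule.linearMap_qext _ rfl)
  map_smul' _ _ := ContinuousLinearMap.coe_injective (Submodule.linearMap_qext _ rfl)
  left_inv _ := rfl
  right_inv _ := ContinuousLinearMap.coe_injective (Submodule.linearMap_qext _ rfl)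

end PoissonStructure

end PoissonCasimir

end

theorem mainTheorem9 {E : Type*} [NormedAddCommGroup E] [NormedSpace ℝ E] [FiniteDimensional ℝ E]
    {M : Type*} [TopologicalSpace M] [ChartedSpace E M] [IsManifold 𝓘(ℝ, E) ∞ M]
    [T2Space M] [CompactSpace M] (P : PoissonCasimir.PoissonStructure E M) :
    P.boundaries =
        Submodule.span ℝ {h : PoissonCasimir.Smooth E M | ∃ f g, h = P.bracket f g} ∧
      ∃ e : P.generalizedCasimirs ≃ₗ[ℝ] (P.H0 →L[ℝ] ℝ),
        ∀ (Φ : P.generalizedCasimirs) (ψ : PoissonCasimir.testFunctions E M),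
          e Φ (P.boundaries.mkQ ψ) =
            ((Φ : PoissonCasimir.distributions E M) : PoissonCasimir.testFunctions E M →ₗ[ℝ] ℝ) ψ
      :=
  ⟨P.boundaries_eq_span_bracket, P.casimirEquivDual, fun _ _ => rfl⟩
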